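/- A $C$-presentation is a finite group presentation $\langle x_1,\dots,x_m \mid x_i = w_{i,j,k}^{-1}x_jw_{i,j,k},\ 1\le i,j\le m,\ 1\le k\le h(i,j)\rangle$ with $m\ge 1$, non-negative integers $h(i,j)$, and words $w_{i,j,k}$ in the free group on $x_1,\dots,x_m$; a $C$-group is a group together with such a presentation, its $C$-generators are the conjugates of the $x_i$, and $C$-groups are considered up to isomorphisms that (in both directions) map $C$-generators to $C$-generators. A $C$-group is a Hurwitz $C$-group if it possesses a $C$-presentation, with generators $x_1,\dots,x_m$ say, such that for every $i$ one has $h(i,i)\ge 1$ and $w_{i,i,1}=x_1x_2\cdots x_m$. For a $C$-group $G$ let $\nu:G\to\mathbb Z$ be the epimorphism sending every $C$-generator to $1$, let $N=\ker\nu$, and let $h_{\mathbb C}$ be the automorphism of $(N/N')\otimes\mathbb C$ induced by $g\mapsto x^{-1}gx$, where $x$ is any $C$-generator and $N'$ is the commutator subgroup of $N$. The Alexander polynomial of $G$ is $\Delta(t)=\det(h_{\mathbb C}-t\,\mathrm{Id})$ (and $\Delta=0$ if $(N/N')\otimes\mathbb C$ is infinite dimensional). **Theorem.** Let $P(t)=(-1)^mt^m+\sum_{i=0}^{m-1}a_it^i\in\mathbb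 Z[t]$, $m\ge 0$, be a polynomial such that (i) all complex roots of $P(t)$ are roots of unity; (ii) if $\zeta\in\mathbb C$ is a primitive $p^k$-th root of unity, where $p$ is a prime number, then the multiplicity of $t=\zeta$ as a root of $P(t)$ is not greater than the multiplicity of $t=1$ as a root of $P(t)$ (a multiplicity is $0$ if the number is not a root). Then $P(t)$ is the Alexander polynomial of some Hurwitz $C$-group $G$. -/

import Mathlib

open scoped TensorProduct

/-- A finite `C`-presentation
`⟨x_1, …, x_m ∣ x_i = w_{i,j,k}⁻¹ x_j w_{i,j,k}, 1 ≤ i, j ≤ m, 1 ≤ k ≤ h(i,j)⟩`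
on `m ≥ 1` generators (numbered from `0` here), with words `w_{i,j,k}` in the free group on the
generators. -/
structure CPresentation where
  m : ℕ
  m_pos : 0 < m
  h : Fin m → Fin m → ℕ
  w : (i j : Fin m) → Fin (h i j) → FreeGroup (Fin m)

namespace CPresentation

/-- The relators `w_{i,j,k}⁻¹ x_j w_{i,j,k} x_i⁻¹`. -/
def rels (P : CPresentation) : Set (FreeGroup (Fin P.m)) :=
  {r | ∃ (i j : Fin P.m) (k : Fin (P.h i j)),
    r = (P.w i j k)⁻¹ * FreeGroup.of j * P.w i j k * (FreeGroup.of i)⁻¹}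

/-- The `C`-group defined by a `C`-presentation. -/
abbrev Group (P : CPresentation) : Type := PresentedGroup P.rels

/-- The image of the generator `x_i` in the `C`-group. -/
def gen (P : CPresentation) (i : Fin P.m) : P.Group := PresentedGroup.of i

/-- The `C`-generators of a `C`-group: the elements conjugate to one of the `x_i`. -/
def IsCGenerator (P : CPresentation) (g : P.Group) : Prop :=
  ∃ i : Fin P.m, IsConj (P.gen i) g

/-- A homomorphism of `C`-groups is a `C`-homomorphism if it sends `C`-generators to
`C`-generators. -/
def IsCHom {P Q : CPresentation} (f : P.Group →* Q.Group) : Prop :=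
  ∀ g : P.Group, P.IsCGenerator g → Q.IsCGenerator (f g)

/-- Two `C`-groups are `C`-isomorphic. -/
def CIsomorphic (P Q : CPresentation) : Prop :=
  ∃ e : P.Group ≃* Q.Group, IsCHom e.toMonoidHom ∧ IsCHom e.symm.toMonoidHom

/-- A Hurwitz `C`-presentation (of degree `m`): for every `i` the first of the words `w_{i,i,k}`
exists and is the product `x_1 ⋯ x_m`. -/
def IsHurwitzPresentation (P : CPresentation) : Prop :=
  ∀ i : Fin P.m, ∃ hi : 0 < P.h i i,
    P.w i i ⟨0, hi⟩ = (List.ofFn fun j : Fin P.m => FreeGroup.of j).prod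

/-- A Hurwitz `C`-group is a `C`-group that possesses a Hurwitz `C`-presentation of some degree
(`C`-groups being considered up to `C`-isomorphism). -/
def IsHurwitzCGroup (P : CPresentation) : Prop :=
  ∃ Q : CPresentation, Q.IsHurwitzPresentation ∧ P.CIsomorphic Q

theorem lift_rels_eq_one (P : CPresentation) :
    ∀ r ∈ P.rels, FreeGroup.lift (fun _ : Fin P.m => Multiplicative.ofAdd (1 : ℤ)) r = 1 := by
  rintro r ⟨i, j, k, rfl⟩
  simp only [map_mul, map_inv, FreeGroup.lift_apply_of]
  rw [inv_mul_cancel_comm, mul_inv_cancel]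

/-- The canonical epimorphism `ν` onto the infinite cyclic group, sending every `C`-generator to
the distinguished generator. -/
def nu (P : CPresentation) : P.Group →* Multiplicative ℤ :=
  PresentedGroup.toGroup P.lift_rels_eq_one

/-- The kernel `N` of `ν`. -/
abbrev N (P : CPresentation) : Subgroup P.Group := P.nu.ker

/-- `N / N'`, written additively. -/
abbrev NAb (P : CPresentation) : Type := Additive (Abelianization P.N)

/-- The endomorphism of `N / N'` induced by the conjugation `g ↦ x⁻¹ g x`. -/
noncomputable def conjAb (P : CPresentation) (x : P.Group) : P.NAb →ₗ[ℤ] P.NAb :=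
  (MonoidHom.toAdditive
    (Abelianization.map (MulAut.conjNormal (H := P.N) x⁻¹).toMonoidHom)).toIntLinearMap

/-- The conjugation action on `N / N'` depends only on the image under `ν`; in particular all
`C`-generators act in the same way. -/
theorem conjAb_eq_of_nu_eq (P : CPresentation) {x y : P.Group} (hxy : P.nu x = P.nu y) :
    P.conjAb x = P.conjAb y := by
  have key : ∀ a : Abelianization P.N,
      Abelianization.map (MulAut.conjNormal (H := P.N) x⁻¹).toMonoidHom a =
      Abelianization.map (MulAut.conjNormal (H := P.N) y⁻¹).toMonoidHom a := by
    intro a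
    induction a using QuotientGroup.induction_on with
    | H n =>
      have hz : x⁻¹ * y ∈ P.N := by simp [MonoidHom.mem_ker, hxy]
      have e : (MulAut.conjNormal (H := P.N) x⁻¹) n =
          ⟨x⁻¹ * y, hz⟩ * (MulAut.conjNormal (H := P.N) y⁻¹) n * ⟨x⁻¹ * y, hz⟩⁻¹ := by
        apply Subtype.ext
        simp [mul_assoc]
      change Abelianization.of ((MulAut.conjNormal (H := P.N) x⁻¹) n) =
        Abelianization.of ((MulAut.conjNormal (H := P.N) y⁻¹) n)
      rw [e, map_mul, map_mul, map_inv Abelianization.of, mul_inv_cancel_comm]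
  ext a
  exact key a

/-- The action `h` of the generator of the infinite cyclic group on `N / N'`: conjugation
`g ↦ x⁻¹ g x` by a `C`-generator `x` (the first one; see `conjAb_eq_of_nu_eq`). -/
noncomputable def monodromy (P : CPresentation) : P.NAb →ₗ[ℤ] P.NAb :=
  P.conjAb (P.gen ⟨0, P.m_pos⟩)

/-- The induced action `h_ℂ` on `(N / N') ⊗ ℂ`. -/
noncomputable def monodromyC (P : CPresentation) : (ℂ ⊗[ℤ] P.NAb) →ₗ[ℂ] (ℂ ⊗[ℤ] P.NAb) :=
  P.monodromy.baseChange ℂ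

open Classical in
/-- The Alexander polynomial `Δ(t) = det (h_ℂ - t Id) = (-1) ^ dim · det (t Id - h_ℂ)`, and
`Δ = 0` if `(N / N') ⊗ ℂ` is infinite dimensional. -/
noncomputable def alexanderPolynomial (P : CPresentation) : Polynomial ℂ :=
  if _hfin : Module.Finite ℂ (ℂ ⊗[ℤ] P.NAb) then
    (-1) ^ Module.finrank ℂ (ℂ ⊗[ℤ] P.NAb) * P.monodromyC.charpoly
  else 0

end CPresentation

/-! Write `P = (-1) ^ m * Q` with `Q` monic, and choose `E` so that every root of `Q` is an `E`-th
root of unity. Repeatedly splitting off the squarefree radical gives `Q = ∏ g_a` with `g_a ∣ X ^ E -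
1` and `g_a(1) ∈ {0, 1}` (`exists_list_prod_eq`). Indeed, if 1 is not a root, condition (ii) leaves
only cyclotomic factors `Φ_n` with `n` not a prime power, and these satisfy `Φ_n(1) = 1`.

It remains to realise `A = ⨁ ℤ[X]/(g_a)` as `N/N'`, with monodromy multiplication by `X`. In an
extension of `ℤ` by a module with automorphism `T`, put `x_0 = (0, 1)` and `x_a = (d, 1)`.
Conjugating `(e, 1)` by `(v, 0)` gives `(e - (T - 1)v, 1)`. Write `g_a = g_a(1) + (X - 1)q` and let
`w` be a word in `x_0, x_a` with value `(q(T)d, 0)`. Then the C-relation `x_a = w⁻¹ x_a w` (if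
`g_a(1) = 0`) or `x_a = w⁻¹ x_0 w` (if `g_a(1) = 1`) says exactly that `g_a(T)d = 0`
(`conjProd_relation_iff`).

For the Hurwitz condition, each `x_a` is repeated `E` times, so that the product of all generators
becomes `x_0^E ⋯ x_s^E`. Since `T ^ E = 1` on `A`, this is central in the extension of `ℤ` by `A`
(`pow_mem_center`), and the Hurwitz relations impose nothing more on `N/N'`. The characteristic
polynomial of `X` on `A` is `∏ g_a = Q`. -/

open Polynomial

/-! ### Extensions of `ℤ` by a module with an automorphism. -/

/-- The extension of the infinite cyclic group by an abelian group `M` on which the generator acts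
through `T`: the pair `(v, n)` stands for `τ ^ n * v`, where `τ⁻¹ * v * τ = T v`. -/
@[ext]
structure CyclicExt {M : Type*} [AddCommGroup M] (T : (Module.End ℤ M)ˣ) where
  vec : M
  deg : ℤ

namespace CyclicExt

variable {M : Type*} [AddCommGroup M] {T : (Module.End ℤ M)ˣ}

instance : Mul (CyclicExt T) := ⟨fun x y => ⟨T ^ y.deg • x.vec + y.vec, x.deg + y.deg⟩⟩
instance : One (CyclicExt T) := ⟨⟨0, 0⟩⟩
instance : Inv (CyclicExt T) := ⟨fun x => ⟨-(T ^ (-x.deg) • x.vec), -x.deg⟩⟩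

@[simp] theorem mul_vec (x y : CyclicExt T) : (x * y).vec = T ^ y.deg • x.vec + y.vec := rfl
@[simp] theorem mul_deg (x y : CyclicExt T) : (x * y).deg = x.deg + y.deg := rfl
@[simp] theorem one_vec : (1 : CyclicExt T).vec = 0 := rfl
@[simp] theorem one_deg : (1 : CyclicExt T).deg = 0 := rfl
@[simp] theorem inv_vec (x : CyclicExt T) : x⁻¹.vec = -(T ^ (-x.deg) • x.vec) := rfl
@[simp] theorem inv_deg (x : CyclicExt T) : x⁻¹.deg = -x.deg := rfl

instance : Group (CyclicExt T) :=
  Group.ofLeftAxioms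
    (fun x y z => by
      ext
      · simp only [mul_vec, mul_deg, smul_add, smul_smul, ← zpow_add, add_assoc]
        rw [add_comm y.deg]
      · simp [add_assoc])
    (fun x => by ext <;> simp)
    (fun x => by ext <;> simp [smul_smul])

/-- The projection to the infinite cyclic group. -/
def degHom : CyclicExt T →* Multiplicative ℤ where
  toFun x := Multiplicative.ofAdd x.deg
  map_one' := rfl
  map_mul' _ _ := rfl

theorem map_zpow_smul {M' : Type*} [AddCommGroup M'] {U : (Module.End ℤ M')ˣ} {f : M →ₗ[ℤ] M'}
    (hf : ∀ v, f (T • v) = U • f v) (n : ℤ) (v : M) : f (T ^ n • v) = U ^ n • f v := by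
  have key : ∀ (n : ℕ) (v : M), f (T ^ n • v) = U ^ n • f v := by
    intro n
    induction n with
    | zero => simp
    | succ n ih => intro v; rw [pow_succ, pow_succ, mul_smul, mul_smul, ih, hf]
  obtain ⟨n, rfl | rfl⟩ := n.eq_nat_or_neg
  · simpa using key n v
  · rw [zpow_neg, zpow_neg, eq_inv_smul_iff, zpow_natCast, zpow_natCast, ← key, smul_inv_smul]

/-- An equivariant linear map extends to a homomorphism of the extensions. -/
def map {M' : Type*} [AddCommGroup M'] {U : (Module.End ℤ M')ˣ} (f : M →ₗ[ℤ] M')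
    (hf : ∀ v, f (T • v) = U • f v) : CyclicExt T →* CyclicExt U where
  toFun x := ⟨f x.vec, x.deg⟩
  map_one' := by ext <;> simp
  map_mul' x y := by ext <;> simp [map_zpow_smul hf]

theorem pow_of_one (d : M) (n : ℕ) :
    (⟨d, 1⟩ : CyclicExt T) ^ n = ⟨∑ k ∈ Finset.range n, T ^ k • d, n⟩ := by
  induction n with
  | zero => ext <;> simp
  | succ n ih =>
    rw [pow_succ, ih]
    ext
    · simp [Finset.sum_range_succ', Finset.smul_sum, smul_smul, pow_succ']
    · simp

/-- The power has degree `E`, so it commutes with the vectors because `T ^ E = 1`. It also commutes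
with `(d, 1)`, and every element is a power of `(d, 1)` times a vector. -/
theorem pow_mem_center {E : ℕ} (hT : T ^ E = 1) (d : M) :
    (⟨d, 1⟩ : CyclicExt T) ^ E ∈ Subgroup.center (CyclicExt T) := by
  rw [Subgroup.mem_center_iff]
  have hcomm : ∀ v : M, (⟨v, 0⟩ : CyclicExt T) * ⟨d, 1⟩ ^ E = ⟨d, 1⟩ ^ E * ⟨v, 0⟩ := by
    intro v
    rw [pow_of_one]
    ext
    · simp [hT, add_comm]
    · simp
  have hgen : ∀ n : ℤ, (⟨d, 1⟩ : CyclicExt T) ^ n * ⟨d, 1⟩ ^ E = ⟨d, 1⟩ ^ E * ⟨d, 1⟩ ^ n := by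
    intro n
    rw [← zpow_natCast, ← zpow_add, ← zpow_add, add_comm]
  intro x
  have hdeg : ((⟨d, 1⟩ : CyclicExt T) ^ x.deg).deg = x.deg := by
    have := congrArg Multiplicative.toAdd (map_zpow (degHom (T := T)) ⟨d, 1⟩ x.deg)
    simpa [degHom] using this
  have hx : x = ⟨d, 1⟩ ^ x.deg * ⟨((⟨d, 1⟩ : CyclicExt T) ^ (-x.deg) * x).vec, 0⟩ := by
    have : (⟨((⟨d, 1⟩ : CyclicExt T) ^ (-x.deg) * x).vec, 0⟩ : CyclicExt T) =
        ⟨d, 1⟩ ^ (-x.deg) * x := by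
      ext
      · rfl
      · simp [hdeg]
    rw [this, zpow_neg, mul_inv_cancel_left]
  rw [hx, mul_assoc, hcomm, ← mul_assoc, hgen, mul_assoc]

theorem zpow_deg_zero (v : M) (n : ℤ) : (⟨v, 0⟩ : CyclicExt T) ^ n = ⟨n • v, 0⟩ := by
  let ι : Multiplicative M →* CyclicExt T :=
    { toFun := fun v => ⟨v.toAdd, 0⟩
      map_one' := rfl
      map_mul' := fun x y => by ext <;> simp }
  exact (map_zpow ι (Multiplicative.ofAdd v) n).symm

theorem conj_pow (v : M) (n : ℕ) :
    ((⟨0, 1⟩ : CyclicExt T) ^ n)⁻¹ * ⟨v, 0⟩ * ⟨0, 1⟩ ^ n = ⟨T ^ n • v, 0⟩ := by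
  rw [pow_of_one]
  ext <;> simp

/-- Conjugation by a vector moves a degree-one element by the coboundary `(T - 1)v`; this is the
source of the factor `X - 1` in the relations. -/
theorem conj_deg_zero (v e : M) :
    (⟨v, 0⟩ : CyclicExt T)⁻¹ * ⟨e, 1⟩ * ⟨v, 0⟩ = ⟨e - T • v + v, 1⟩ := by
  ext
  · simp; abel
  · simp

end CyclicExt

/-! ### Words that realise integral polynomials in `T`. -/

/-- The product of the elements `x ^ (-k) * (x⁻¹ * y) ^ (q k) * x ^ k`, where the `q k` are the
coefficients of the polynomial `q`. -/
noncomputable def conjProd {H : Type*} [Group H] (x y : H) (q : ℤ[X]) : H :=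
  ((List.range (q.natDegree + 1)).map
    fun k => (x ^ k)⁻¹ * (x⁻¹ * y) ^ q.coeff k * x ^ k).prod

theorem map_conjProd {H K : Type*} [Group H] [Group K] (f : H →* K) (x y : H) (q : ℤ[X]) :
    f (conjProd x y q) = conjProd (f x) (f y) q := by
  simp [conjProd, map_list_prod, Function.comp_def]

/-- Here `x⁻¹ * y` is the vector `d`, conjugation by `x ^ k` applies `T ^ k`, and products of
vectors are sums. -/
theorem CyclicExt.conjProd_eq {M : Type*} [AddCommGroup M] {T : (Module.End ℤ M)ˣ} (d : M)
    (q : ℤ[X]) : conjProd (⟨0, 1⟩ : CyclicExt T) ⟨d, 1⟩ q =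
      ⟨aeval (T : Module.End ℤ M) q d, 0⟩ := by
  have h1 : (⟨0, 1⟩ : CyclicExt T)⁻¹ * ⟨d, 1⟩ = ⟨d, 0⟩ := by ext <;> simp
  rw [conjProd, aeval_eq_sum_range, h1]
  simp only [zpow_deg_zero, conj_pow]
  generalize q.natDegree + 1 = n
  induction n with
  | zero => simp; rfl
  | succ n ih =>
    rw [List.range_succ, List.map_append, List.prod_append, ih, Finset.sum_range_succ]
    ext
    · simp [Units.smul_def]
    · simp

/-! ### The monodromy module `N/N'` and its universal property. -/

namespace CPresentation

variable (P : CPresentation)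

theorem nu_gen (i : Fin P.m) : P.nu (P.gen i) = Multiplicative.ofAdd 1 := by
  simp [nu, gen]

theorem conjAb_of (x : P.Group) (n : P.N) : P.conjAb x (Additive.ofMul (Abelianization.of n)) =
    Additive.ofMul (Abelianization.of (MulAut.conjNormal (H := P.N) x⁻¹ n)) := rfl

/-- The conjugation action `n ↦ g * n * g⁻¹` of a `C`-group on `N / N'`. -/
noncomputable def conjRep : P.Group →* Module.End ℤ P.NAb where
  toFun g := P.conjAb g⁻¹
  map_one' := by
    refine LinearMap.ext fun a => ?_
    induction a using QuotientGroup.induction_on with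
    | H n => exact (P.conjAb_of _ n).trans (by simp; rfl)
  map_mul' g g' := by
    refine LinearMap.ext fun a => ?_
    induction a using QuotientGroup.induction_on with
    | H n =>
      change P.conjAb _ (Additive.ofMul (Abelianization.of n)) =
        P.conjAb _ (P.conjAb _ (Additive.ofMul (Abelianization.of n)))
      simp only [conjAb_of, inv_inv, map_mul, MulAut.mul_apply]

/-- The monodromy as a unit of the endomorphism ring. -/
noncomputable def monodromyUnit : (Module.End ℤ P.NAb)ˣ :=
  P.conjRep.toHomUnits (P.gen ⟨0, P.m_pos⟩)⁻¹

theorem coe_monodromyUnit : (P.monodromyUnit : Module.End ℤ P.NAb) = P.monodromy := by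
  change P.conjAb (_)⁻¹⁻¹ = _
  rw [inv_inv]
  rfl

theorem monodromyUnit_zpow_smul (k : ℤ) (n : P.N) :
    P.monodromyUnit ^ k • (Additive.ofMul (Abelianization.of n) : P.NAb) =
      Additive.ofMul (Abelianization.of
        (MulAut.conjNormal (H := P.N) (P.gen ⟨0, P.m_pos⟩ ^ (-k)) n)) := by
  rw [monodromyUnit, ← map_zpow, inv_zpow']
  change P.conjAb _ _ = _
  rw [conjAb_of, inv_inv]

/-- The element `x ^ (-ν g) * g` of `N`, where `x` is the first generator. -/
noncomputable def toN (g : P.Group) : P.N :=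
  ⟨P.gen ⟨0, P.m_pos⟩ ^ (-(P.nu g).toAdd) * g, by
    rw [MonoidHom.mem_ker, map_mul, map_zpow, nu_gen, ← ofAdd_zsmul]
    simp⟩

theorem toN_coe (n : P.N) : P.toN n = n := by
  ext
  simp [toN, MonoidHom.mem_ker.mp n.2]

/-- The homomorphism from a `C`-group to the extension of `ℤ` by `N / N'`. -/
noncomputable def toCyclicExt : P.Group →* CyclicExt P.monodromyUnit where
  toFun g := ⟨Additive.ofMul (Abelianization.of (P.toN g)), (P.nu g).toAdd⟩
  map_one' := by
    ext
    · have : P.toN 1 = 1 := P.toN_coe 1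
      simp [this]
    · simp
  map_mul' g g' := by
    ext
    · simp only [CyclicExt.mul_vec]
      rw [monodromyUnit_zpow_smul, ← ofMul_mul, ← map_mul]
      refine congrArg (fun k => Additive.ofMul (Abelianization.of k)) (Subtype.ext ?_)
      simp only [toN, Subgroup.coe_mul, MulAut.conjNormal_apply, map_mul, toAdd_mul]
      group
    · simp

theorem toCyclicExt_gen (i : Fin P.m) : (P.toCyclicExt (P.gen i)).deg = 1 := by
  simp [toCyclicExt, nu_gen]

theorem toCyclicExt_gen_zero : P.toCyclicExt (P.gen ⟨0, P.m_pos⟩) = ⟨0, 1⟩ := by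
  ext
  · have : P.toN (P.gen ⟨0, P.m_pos⟩) = 1 := by
      ext
      simp [toN, nu_gen]
    simp [toCyclicExt, this]
  · exact P.toCyclicExt_gen _

/-- `N / N'` is determined by its universal property among the extensions of `ℤ`. -/
theorem exists_equiv_NAb {A : Type*} [AddCommGroup A] {T : (Module.End ℤ A)ˣ}
    (Ψ : P.Group →* CyclicExt T) (hdeg : ∀ i, (Ψ (P.gen i)).deg = 1)
    (h0 : (Ψ (P.gen ⟨0, P.m_pos⟩)).vec = 0) (φ : A →ₗ[ℤ] P.NAb)
    (hφ : ∀ a, φ (T • a) = P.monodromyUnit • φ a)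
    (hφgen : ∀ i, φ (Ψ (P.gen i)).vec = (P.toCyclicExt (P.gen i)).vec)
    (hgen : ∀ S : Submodule ℤ A, (∀ a ∈ S, T • a ∈ S) → (∀ i, (Ψ (P.gen i)).vec ∈ S) → S = ⊤) :
    ∃ e : A ≃ₗ[ℤ] P.NAb, ∀ a, e (T • a) = P.monodromy (e a) := by
  -- Both homomorphisms to `ℤ` send each generator to 1. Hence `Ψ` maps `N` into the degree-zero
  -- part `A`, and it induces `ψ : N/N' → A`.
  have hν : CyclicExt.degHom.comp Ψ = P.nu := by
    refine PresentedGroup.ext fun i => ?_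
    refine Eq.trans ?_ (P.nu_gen i).symm
    exact congrArg Multiplicative.ofAdd (hdeg i)
  have hdeg0 : ∀ n : P.N, (Ψ n).deg = 0 := fun n =>
    congrArg Multiplicative.toAdd ((DFunLike.congr_fun hν (n : P.Group)).trans n.2)
  have hcomp : (CyclicExt.map φ hφ).comp Ψ = P.toCyclicExt := by
    refine PresentedGroup.ext fun i => ?_
    ext
    · exact hφgen i
    · exact (hdeg i).trans (P.toCyclicExt_gen i).symm
  let ψ₀ : P.N →* Multiplicative A :=
    { toFun := fun n => Multiplicative.ofAdd (Ψ n).vec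
      map_one' := by simp
      map_mul' := fun x y => by simp [hdeg0] }
  let ψ : P.NAb →ₗ[ℤ] A := (MonoidHom.toAdditiveLeft (Abelianization.lift ψ₀)).toIntLinearMap
  have hψ : ∀ n : P.N, ψ (Additive.ofMul (Abelianization.of n)) = (Ψ n).vec := fun n => rfl
  have h0' : Ψ (P.gen ⟨0, P.m_pos⟩) = ⟨0, 1⟩ := by
    ext
    · exact h0
    · exact hdeg _
  have hψT : ∀ b, ψ (P.monodromyUnit • b) = T • ψ b := by
    intro b
    induction b using QuotientGroup.induction_on with
    | H n =>
      have := P.monodromyUnit_zpow_smul 1 n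
      rw [zpow_one] at this
      refine (congrArg ψ this).trans ?_
      rw [hψ]
      refine Eq.trans ?_ (congrArg (T • ·) (hψ n)).symm
      simp [h0', hdeg0]
  -- `φ` after `Ψ` agrees with the canonical map to the extension by `N/N'`, which restricts on `N`
  -- to the quotient map.
  have hφψ : ∀ b, φ (ψ b) = b := by
    intro b
    induction b using QuotientGroup.induction_on with
    | H n =>
      refine (congrArg φ (hψ n)).trans ?_
      refine (congrArg CyclicExt.vec (DFunLike.congr_fun hcomp (n : P.Group))).trans ?_
      exact congrArg (fun k => Additive.ofMul (Abelianization.of k)) (P.toN_coe n)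
  have hψφ : ∀ a, ψ (φ a) = a := by
    -- The locus where `ψ ∘ φ` is the identity is `T`-stable and contains the vectors of all
    -- generators, so it is everything.
    have htop := hgen (LinearMap.eqLocus (ψ ∘ₗ φ) LinearMap.id)
      (fun a ha => by
        have ha' : ψ (φ a) = a := ha
        change ψ (φ (T • a)) = T • a
        rw [hφ, hψT, ha'])
      (fun i => by
        change ψ (φ _) = _
        rw [hφgen]
        refine (hψ (P.toN (P.gen i))).trans ?_
        simp [toN, nu_gen, h0', hdeg])
    intro a
    have : a ∈ LinearMap.eqLocus (ψ ∘ₗ φ) LinearMap.id := htop ▸ Submodule.mem_top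
    exact this
  refine ⟨LinearEquiv.ofLinearMap φ ψ (LinearMap.ext hφψ) (LinearMap.ext hψφ), fun a => ?_⟩
  rw [← coe_monodromyUnit]
  exact hφ a

end CPresentation

/-! ### The modules `ℤ[X]/(g)` and their direct sums. -/

/-- For every linear endomorphism `h` and every vector `b` killed by `g h`, there is a linear map
from `ℤ[X] / (g)` sending the class of `p` to `p h b`. -/
theorem AdjoinRoot.exists_lift_aeval {B : Type*} [AddCommGroup B] (h : Module.End ℤ B) (b : B)
    {g : ℤ[X]} (hb : aeval h g b = 0) :
    ∃ f : AdjoinRoot g →ₗ[ℤ] B, ∀ p, f (AdjoinRoot.mk g p) = aeval h p b := by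
  let k : ℤ[X] →+ B :=
    { toFun := fun p => aeval h p b
      map_zero' := by simp
      map_add' := fun p q => by simp }
  have hk : (AdjoinRoot.mk g : ℤ[X] →+ AdjoinRoot g).ker ≤ k.ker := by
    intro p hp
    obtain ⟨r, rfl⟩ := AdjoinRoot.mk_eq_zero.mp hp
    change aeval h (g * r) b = 0
    rw [mul_comm, map_mul, Module.End.mul_apply, hb, map_zero]
  refine ⟨(AddMonoidHom.liftOfSurjective (AdjoinRoot.mk g : ℤ[X] →+ AdjoinRoot g)
    AdjoinRoot.mk_surjective ⟨k, hk⟩).toIntLinearMap, fun p => ?_⟩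
  exact AddMonoidHom.liftOfRightInverse_comp_apply _ _
    (Function.rightInverse_surjInv AdjoinRoot.mk_surjective) ⟨k, hk⟩ p

theorem aeval_apply_mem {M : Type*} [AddCommGroup M] {h : Module.End ℤ M} {S : Submodule ℤ M}
    (hS : ∀ a ∈ S, h a ∈ S) (p : ℤ[X]) {d : M} (hd : d ∈ S) : aeval h p d ∈ S := by
  have hpow : ∀ n : ℕ, (h ^ n) d ∈ S := by
    intro n
    induction n with
    | zero => exact hd
    | succ n ih => rw [pow_succ', Module.End.mul_apply]; exact hS _ ih
  rw [aeval_eq_sum_range, LinearMap.sum_apply]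
  exact S.sum_mem fun k _ => S.smul_mem _ (hpow k)

section PolyModule

variable {s : ℕ} (g : Fin s → ℤ[X])

/-- The direct sum of the cyclic modules `ℤ[X] / (g a)`. -/
abbrev PolyModule : Type := ∀ a, AdjoinRoot (g a)

/-- The class of the indeterminate. -/
noncomputable def PolyModule.root : PolyModule g := fun a => AdjoinRoot.root (g a)

theorem PolyModule.aeval_root (p : ℤ[X]) :
    aeval (PolyModule.root g) p = fun a => AdjoinRoot.mk (g a) p := by
  funext a
  rw [← AdjoinRoot.aeval_eq]
  exact (aeval_algHom_apply (Pi.evalAlgHom ℤ (fun a => AdjoinRoot (g a)) a)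
    (PolyModule.root g) p).symm

variable {g} {E : ℕ}

theorem PolyModule.root_pow (hE : ∀ a, g a ∣ X ^ E - 1) : PolyModule.root g ^ E = 1 := by
  have h : aeval (PolyModule.root g) (X ^ E - 1 : ℤ[X]) = 0 := by
    rw [aeval_root]
    exact funext fun a => AdjoinRoot.mk_eq_zero.mpr (hE a)
  rwa [map_sub, map_pow, aeval_X, map_one, sub_eq_zero] at h

/-- Multiplication by the indeterminate. -/
noncomputable def PolyModule.mulX (hE0 : E ≠ 0) (hE : ∀ a, g a ∣ X ^ E - 1) :
    (Module.End ℤ (PolyModule g))ˣ :=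
  Units.map (Algebra.lmul ℤ (PolyModule g))
    (Units.ofPowEqOne (PolyModule.root g) E (PolyModule.root_pow hE) hE0)

theorem PolyModule.coe_mulX (hE0 : E ≠ 0) (hE : ∀ a, g a ∣ X ^ E - 1) :
    (PolyModule.mulX hE0 hE : Module.End ℤ (PolyModule g)) =
      Algebra.lmul ℤ (PolyModule g) (PolyModule.root g) := rfl

theorem PolyModule.mulX_smul (hE0 : E ≠ 0) (hE : ∀ a, g a ∣ X ^ E - 1) (x : PolyModule g) :
    PolyModule.mulX hE0 hE • x = PolyModule.root g * x := rfl

theorem PolyModule.mulX_pow (hE0 : E ≠ 0) (hE : ∀ a, g a ∣ X ^ E - 1) :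
    PolyModule.mulX hE0 hE ^ E = 1 := by
  rw [mulX, ← map_pow, Units.pow_ofPowEqOne, map_one]

theorem PolyModule.aeval_mulX (hE0 : E ≠ 0) (hE : ∀ a, g a ∣ X ^ E - 1) (p : ℤ[X])
    (x : PolyModule g) :
    aeval (PolyModule.mulX hE0 hE : Module.End ℤ (PolyModule g)) p x =
      fun a => AdjoinRoot.mk (g a) p * x a := by
  rw [coe_mulX, aeval_algHom_apply, aeval_root]
  rfl

theorem PolyModule.aeval_mulX_single (hE0 : E ≠ 0) (hE : ∀ a, g a ∣ X ^ E - 1) (p : ℤ[X])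
    (a : Fin s) :
    aeval (PolyModule.mulX hE0 hE : Module.End ℤ (PolyModule g)) p (Pi.single a 1) =
      Pi.single a (AdjoinRoot.mk (g a) p) := by
  rw [aeval_mulX]
  funext b
  obtain rfl | hb := eq_or_ne b a
  · simp
  · simp [Pi.single_eq_of_ne hb]

/-- Universal property of the sum of cyclic modules: an equivariant map is determined by vectors `b
a` killed by `g a`. It supplies the map from the model module to `N/N'`. -/
theorem PolyModule.exists_lift {B : Type*} [AddCommGroup B] (U : (Module.End ℤ B)ˣ)
    (b : Fin s → B) (hb : ∀ a, aeval (U : Module.End ℤ B) (g a) (b a) = 0)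
    (hE0 : E ≠ 0) (hE : ∀ a, g a ∣ X ^ E - 1) :
    ∃ f : PolyModule g →ₗ[ℤ] B, (∀ a, f (Pi.single a 1) = b a) ∧
      ∀ x, f (PolyModule.mulX hE0 hE • x) = U • f x := by
  choose f hf using fun a => AdjoinRoot.exists_lift_aeval (U : Module.End ℤ B) (b a) (hb a)
  refine ⟨LinearMap.lsum ℤ _ ℤ f, fun a => ?_, fun x => ?_⟩
  · rw [LinearMap.lsum_piSingle, ← map_one (AdjoinRoot.mk (g a)), hf]
    simp
  · simp only [LinearMap.lsum_apply, LinearMap.sum_apply, LinearMap.comp_apply,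
      LinearMap.proj_apply, Finset.smul_sum, mulX_smul]
    refine Finset.sum_congr rfl fun a _ => ?_
    obtain ⟨p, hp⟩ := AdjoinRoot.mk_surjective (x a)
    rw [Pi.mul_apply, ← hp, root, ← AdjoinRoot.mk_X, ← map_mul, hf, hf]
    simp [Units.smul_def]

theorem PolyModule.eq_top_of_invariant (hE0 : E ≠ 0) (hE : ∀ a, g a ∣ X ^ E - 1)
    (S : Submodule ℤ (PolyModule g)) (hS : ∀ x ∈ S, PolyModule.mulX hE0 hE • x ∈ S)
    (h1 : ∀ a, Pi.single a 1 ∈ S) : S = ⊤ := by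
  refine eq_top_iff.mpr fun x _ => ?_
  rw [← Finset.univ_sum_single x]
  refine S.sum_mem fun a _ => ?_
  obtain ⟨p, hp⟩ := AdjoinRoot.mk_surjective (x a)
  rw [← hp, ← aeval_mulX_single hE0 hE]
  exact aeval_apply_mem hS p (h1 a)

end PolyModule

/-! ### A conjugation relation equivalent to `g(T)d = 0`. -/

section Relation

variable {M : Type*} [AddCommGroup M] {T : (Module.End ℤ M)ˣ}

/-- With `q = g /ₘ (X - 1)` one has `g(T)d = g(1)d + (T - 1)q(T)d`, while the relation reads `d = e
- (T - 1)q(T)d`. The two agree when `d - e = g(1)d`. The restriction on `g(1)` is what lets `e` be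
the vector of a generator: `d` for `x_a`, or 0 for `x_0`. -/
theorem conjProd_relation_iff (g : ℤ[X]) (d : M) (hg : g.eval 1 = 0 ∨ g.eval 1 = 1) :
    (⟨d, 1⟩ : CyclicExt T) =
        (conjProd ⟨0, 1⟩ ⟨d, 1⟩ (g /ₘ (X - C 1)))⁻¹ * ⟨if g.eval 1 = 0 then d else 0, 1⟩ *
          conjProd ⟨0, 1⟩ ⟨d, 1⟩ (g /ₘ (X - C 1)) ↔
      aeval (T : Module.End ℤ M) g d = 0 := by
  have key : aeval (T : Module.End ℤ M) g d = g.eval 1 • d +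
      (T • aeval (T : Module.End ℤ M) (g /ₘ (X - C 1)) d -
        aeval (T : Module.End ℤ M) (g /ₘ (X - C 1)) d) := by
    conv_lhs => rw [← modByMonic_add_div g (X - C 1), modByMonic_X_sub_C_eq_C_eval]
    simp [Units.smul_def]
  rw [CyclicExt.conjProd_eq, CyclicExt.conj_deg_zero, CyclicExt.ext_iff, key]
  simp only [and_true]
  rcases hg with hg | hg <;> simp only [hg] <;> simp
  · rw [sub_add, eq_comm, sub_eq_self]
  · rw [← sub_eq_zero]; abel_nf

end Relation

/-! ### The Hurwitz presentation attached to a family of polynomials. -/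

namespace CPresentation

/-- The `C`-presentation with given lists of conjugating words. -/
def ofLists (m : ℕ) (hm : 0 < m) (R : Fin m → Fin m → List (FreeGroup (Fin m))) :
    CPresentation where
  m := m
  m_pos := hm
  h i j := (R i j).length
  w i j k := (R i j).get k

theorem mem_rels_ofLists {m : ℕ} {hm : 0 < m} {R : Fin m → Fin m → List (FreeGroup (Fin m))}
    {r : FreeGroup (Fin m)} :
    r ∈ (ofLists m hm R).rels ↔ ∃ i j, ∃ w ∈ R i j,
      r = w⁻¹ * FreeGroup.of j * w * (FreeGroup.of i)⁻¹ := by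
  constructor
  · rintro ⟨i, j, k, rfl⟩
    exact ⟨i, j, _, List.get_mem (R i j) k, rfl⟩
  · rintro ⟨i, j, w, hw, rfl⟩
    obtain ⟨k, rfl⟩ := List.mem_iff_get.mp hw
    exact ⟨i, j, k, rfl⟩

theorem isHurwitzPresentation_ofLists {m : ℕ} {hm : 0 < m}
    {R : Fin m → Fin m → List (FreeGroup (Fin m))}
    (h : ∀ i, ∃ l, R i i = (List.ofFn fun j : Fin m => FreeGroup.of j).prod :: l) :
    (ofLists m hm R).IsHurwitzPresentation := by
  intro i
  obtain ⟨l, hl⟩ := h i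
  have hpos : 0 < (R i i).length := by simp [hl]
  refine ⟨hpos, ?_⟩
  change (R i i).get ⟨0, hpos⟩ = _
  simp only [List.get_eq_getElem, hl, List.getElem_cons_zero]
  rfl

theorem IsHurwitzPresentation.isHurwitzCGroup {P : CPresentation} (h : P.IsHurwitzPresentation) :
    P.IsHurwitzCGroup :=
  ⟨P, h, MulEquiv.refl _, fun _ hg => hg, fun _ hg => hg⟩

section Construction

variable {s : ℕ} (E : ℕ) (hE0 : E ≠ 0) (g : Fin s → ℤ[X])

/-- The block of a generator. -/
def block (i : Fin ((s + 1) * E)) : Fin (s + 1) := (finProdFinEquiv.symm i).1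

/-- A generator in a given block. -/
def rep (a : Fin (s + 1)) : Fin ((s + 1) * E) := finProdFinEquiv (a, ⟨0, Nat.pos_of_ne_zero hE0⟩)

@[simp] theorem block_rep (a : Fin (s + 1)) : block E (rep E hE0 a) = a := by
  simp [block, rep]

open Classical in
/-- The conjugating words of a Hurwitz `C`-group with `N / N'` isomorphic to the direct sum of the
cyclic modules `ℤ[X] / (g a)`. The generators come in `s + 1` blocks of `E` equal ones. -/
noncomputable def polyWords (i j : Fin ((s + 1) * E)) :
    List (FreeGroup (Fin ((s + 1) * E))) :=
  (if i = j then [(List.ofFn fun j => FreeGroup.of j).prod] else []) ++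
  ((if block E i = block E j then [1] else []) ++
  ((List.finRange s).filter fun a => i = rep E hE0 a.succ ∧
      j = rep E hE0 (if (g a).eval 1 = 0 then a.succ else 0)).map fun a =>
    conjProd (FreeGroup.of (rep E hE0 0)) (FreeGroup.of (rep E hE0 a.succ))
      (g a /ₘ (X - C 1)))

/-- The Hurwitz `C`-presentation given by `polyWords`. -/
noncomputable def ofPolys : CPresentation :=
  ofLists ((s + 1) * E) (Nat.mul_pos s.succ_pos (Nat.pos_of_ne_zero hE0)) (polyWords E hE0 g)

theorem isHurwitz_ofPolys : (ofPolys E hE0 g).IsHurwitzPresentation :=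
  isHurwitzPresentation_ofLists fun i => ⟨_, by rw [polyWords, if_pos rfl]; rfl⟩

/-- The projection of the free group onto the group of `ofPolys`. -/
noncomputable def polyMk : FreeGroup (Fin ((s + 1) * E)) →* (ofPolys E hE0 g).Group :=
  PresentedGroup.mk (ofPolys E hE0 g).rels

/-- A generator of the group of `ofPolys`. -/
noncomputable def polyGen (i : Fin ((s + 1) * E)) : (ofPolys E hE0 g).Group :=
  (ofPolys E hE0 g).gen i

theorem polyGen_relation {i j : Fin ((s + 1) * E)} {w : FreeGroup (Fin ((s + 1) * E))}
    (hw : w ∈ polyWords E hE0 g i j) :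
    polyGen E hE0 g i = (polyMk E hE0 g w)⁻¹ * polyGen E hE0 g j * polyMk E hE0 g w := by
  have h : polyMk E hE0 g (w⁻¹ * FreeGroup.of j * w * (FreeGroup.of i)⁻¹) = 1 :=
    PresentedGroup.one_of_mem (rels := (ofPolys E hE0 g).rels)
      (mem_rels_ofLists.mpr ⟨i, j, w, hw, rfl⟩)
  rw [map_mul, map_mul, map_mul, map_inv, map_inv, mul_inv_eq_one] at h
  exact h.symm

theorem polyGen_eq (i : Fin ((s + 1) * E)) :
    polyGen E hE0 g i = polyGen E hE0 g (rep E hE0 (block E i)) := by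
  have h := polyGen_relation E hE0 g (i := i) (j := rep E hE0 (block E i)) (w := 1)
    (List.mem_append_right _ (List.mem_append_left _ (by simp)))
  simpa using h

theorem polyGen_succ (a : Fin s) :
    polyGen E hE0 g (rep E hE0 a.succ) =
      (conjProd (polyGen E hE0 g (rep E hE0 0)) (polyGen E hE0 g (rep E hE0 a.succ))
        (g a /ₘ (X - C 1)))⁻¹ *
      polyGen E hE0 g (rep E hE0 (if (g a).eval 1 = 0 then a.succ else 0)) *
      conjProd (polyGen E hE0 g (rep E hE0 0)) (polyGen E hE0 g (rep E hE0 a.succ))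
        (g a /ₘ (X - C 1)) := by
  have h := polyGen_relation E hE0 g
    (List.mem_append_right _ (List.mem_append_right _ (List.mem_map.mpr
      ⟨a, List.mem_filter.mpr ⟨List.mem_finRange a, decide_eq_true ⟨rfl, rfl⟩⟩, rfl⟩)))
  rw [map_conjProd] at h
  exact h

/-- Homomorphisms out of the group of `ofPolys`. -/
theorem exists_hom_ofPolys {H : Type*} [_root_.Group H] (y : Fin (s + 1) → H)
    (hcenter : ∀ a, y a ^ E ∈ Subgroup.center H)
    (hy : ∀ a : Fin s, y a.succ = (conjProd (y 0) (y a.succ) (g a /ₘ (X - C 1)))⁻¹ *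
      y (if (g a).eval 1 = 0 then a.succ else 0) *
      conjProd (y 0) (y a.succ) (g a /ₘ (X - C 1))) :
    ∃ f : (ofPolys E hE0 g).Group →* H, ∀ i, f (polyGen E hE0 g i) = y (block E i) := by
  -- The blocks are contiguous, so the product of all generators splits into the factors `y a ^ E`,
  -- each of them central.
  have hprod : (List.ofFn fun j => y (block E j)).prod ∈ Subgroup.center H := by
    rw [List.ofFn_mul, List.prod_flatten]
    refine Subgroup.list_prod_mem _ fun x hx => ?_
    obtain ⟨l, hl, rfl⟩ := List.mem_map.mp hx
    obtain ⟨a, rfl⟩ := List.mem_ofFn.mp hl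
    convert hcenter a using 1
    have hb : ∀ (b : Fin E) (h : a * E + b < (s + 1) * E), block E ⟨a * E + b, h⟩ = a := by
      intro b h
      ext
      simp [block, finProdFinEquiv, Nat.add_comm, Nat.add_mul_div_right _ _ b.pos]
    simp [hb]
  refine ⟨PresentedGroup.toGroup (f := fun i => y (block E i)) ?_, fun i =>
    PresentedGroup.toGroup.of _⟩
  intro r hr
  obtain ⟨i, j, w, hw, rfl⟩ := mem_rels_ofLists.mp hr
  simp only [map_mul, map_inv, FreeGroup.lift_apply_of, mul_inv_eq_one]
  rcases List.mem_append.mp hw with h₁ | h₂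
  · split_ifs at h₁ with hij
    · subst hij
      have hc : FreeGroup.lift (fun i => y (block E i)) w ∈ Subgroup.center H := by
        rw [List.mem_singleton.mp h₁, map_list_prod, List.map_ofFn]
        simpa only [Function.comp_def, FreeGroup.lift_apply_of] using hprod
      -- The Hurwitz relator holds because its conjugating word is central in `H`.
      rw [mul_assoc, Subgroup.mem_center_iff.mp hc, inv_mul_cancel_left]
    · simp at h₁
  rcases List.mem_append.mp h₂ with h₂ | h₃
  · split_ifs at h₂ with hij
    · rw [List.mem_singleton.mp h₂]
      simp [hij]
    · simp at h₂
  · obtain ⟨a, ha, rfl⟩ := List.mem_map.mp h₃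
    obtain ⟨rfl, rfl⟩ := of_decide_eq_true (List.mem_filter.mp ha).2
    rw [map_conjProd]
    simp only [FreeGroup.lift_apply_of, block_rep]
    exact (hy a).symm

/-- The relations hold in the extension by `PolyModule g`, which gives a homomorphism out of the
group. Conversely, they force `g a` to kill the vector of `x_a` in `N/N'`, which gives a map from
`PolyModule g`. The universal property of `N/N'` makes these mutually inverse. -/
theorem exists_equiv_NAb_ofPolys (hE : ∀ a, g a ∣ X ^ E - 1)
    (hg : ∀ a, (g a).eval 1 = 0 ∨ (g a).eval 1 = 1) :
    ∃ e : PolyModule g ≃ₗ[ℤ] (ofPolys E hE0 g).NAb,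
      ∀ x, e (PolyModule.root g * x) = (ofPolys E hE0 g).monodromy (e x) := by
  set P := ofPolys E hE0 g
  -- Block 0 is the base point with zero vector; block `a + 1` carries the generator of the `a`-th
  -- summand.
  let d : Fin (s + 1) → PolyModule g := Fin.cons 0 fun a => Pi.single a 1
  obtain ⟨Ψ, hΨ⟩ := exists_hom_ofPolys E hE0 g
    (fun a => (⟨d a, 1⟩ : CyclicExt (PolyModule.mulX hE0 hE)))
    (fun a => CyclicExt.pow_mem_center (PolyModule.mulX_pow hE0 hE) _)
    (fun a => by
      have h := (conjProd_relation_iff (T := PolyModule.mulX hE0 hE) (g a) (Pi.single a 1)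
        (hg a)).mpr (by rw [PolyModule.aeval_mulX_single]; simp)
      split_ifs at h ⊢ <;> exact h)
  have hblock0 : block E (⟨0, P.m_pos⟩ : Fin ((s + 1) * E)) = 0 := by
    simp [block, finProdFinEquiv, Fin.divNat]
  have hgen : ∀ i : Fin P.m, P.toCyclicExt (P.gen i) =
      P.toCyclicExt (polyGen E hE0 g (rep E hE0 (block E i))) := fun i =>
    congrArg P.toCyclicExt (polyGen_eq E hE0 g i)
  have hrep0 : P.toCyclicExt (polyGen E hE0 g (rep E hE0 0)) = ⟨0, 1⟩ := by
    rw [← P.toCyclicExt_gen_zero, hgen ⟨0, P.m_pos⟩]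
    exact congrArg (fun a => P.toCyclicExt (polyGen E hE0 g (rep E hE0 a))) hblock0.symm
  let b : Fin s → P.NAb := fun a => (P.toCyclicExt (polyGen E hE0 g (rep E hE0 a.succ))).vec
  have hb : ∀ a, P.toCyclicExt (polyGen E hE0 g (rep E hE0 a.succ)) = ⟨b a, 1⟩ := fun a =>
    CyclicExt.ext rfl (P.toCyclicExt_gen _)
  obtain ⟨φ, hφ1, hφ⟩ := PolyModule.exists_lift P.monodromyUnit b (fun a => by
      rw [← conjProd_relation_iff (g a) (b a) (hg a)]
      have h := congrArg P.toCyclicExt (polyGen_succ E hE0 g a)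
      rw [map_mul, map_mul, map_inv, map_conjProd, hrep0, hb] at h
      split_ifs at h ⊢
      · rwa [hb] at h
      · rwa [hrep0] at h) hE0 hE
  have hΨgen : ∀ i : Fin P.m, Ψ (P.gen i) = ⟨d (block E i), 1⟩ := hΨ
  refine P.exists_equiv_NAb Ψ (fun i => by rw [hΨgen]) (by
    rw [hΨgen]
    exact congrArg d hblock0) φ hφ ?_ ?_
  · intro i
    rw [hΨgen, hgen]
    generalize block E i = a
    induction a using Fin.cases with
    | zero => rw [hrep0]; exact map_zero φ
    | succ a => rw [hb]; exact hφ1 a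
  · refine fun S hS hS1 => PolyModule.eq_top_of_invariant hE0 hE S hS fun a => ?_
    have h : (Ψ (polyGen E hE0 g (rep E hE0 a.succ))).vec ∈ S := hS1 _
    rwa [hΨ, block_rep] at h

end Construction

end CPresentation

/-! ### Characteristic polynomials and the Alexander polynomial. -/

/-- A nonzero polynomial of degree below that of `g` cannot vanish at the root, so `g` is its
minimal polynomial; for the generator of a power basis this is the characteristic polynomial of
multiplication. -/
theorem AdjoinRoot.charpoly_lmul_root {g : ℤ[X]} (hg : g.Monic)
    [Module.Free ℤ (AdjoinRoot g)] [Module.Finite ℤ (AdjoinRoot g)] :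
    (Algebra.lmul ℤ (AdjoinRoot g) (AdjoinRoot.root g)).charpoly = g := by
  have hmin : g = minpoly ℤ (AdjoinRoot.root g) := by
    refine minpoly.unique' ℤ _ hg (by simp) fun q hq => ?_
    refine or_iff_not_imp_left.mpr fun hq0 h => ?_
    rw [AdjoinRoot.aeval_eq, AdjoinRoot.mk_eq_zero] at h
    exact hq0 (Polynomial.eq_zero_of_dvd_of_degree_lt h hq)
  have h := charpoly_leftMulMatrix (AdjoinRoot.powerBasis' hg)
  rw [Algebra.leftMulMatrix_apply, LinearMap.charpoly_toMatrix] at h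
  exact h.trans hmin.symm

theorem PolyModule.charpoly_lmul_root {s : ℕ} {g : Fin s → ℤ[X]} (hg : ∀ a, (g a).Monic)
    [∀ a, Module.Free ℤ (AdjoinRoot (g a))] [∀ a, Module.Finite ℤ (AdjoinRoot (g a))] :
    (Algebra.lmul ℤ (PolyModule g) (PolyModule.root g)).charpoly = ∏ a, g a := by
  induction s with
  | zero =>
    rw [Finset.univ_eq_empty, Finset.prod_empty]
    refine ((LinearMap.charpoly_monic _).natDegree_eq_zero).mp ?_
    rw [LinearMap.charpoly_natDegree]
    exact Module.finrank_zero_of_subsingleton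
  | succ s ih =>
    let e := Fin.consLinearEquiv ℤ fun a => AdjoinRoot (g a)
    have he : Algebra.lmul ℤ (PolyModule g) (PolyModule.root g) =
        e.conj ((Algebra.lmul ℤ _ (AdjoinRoot.root (g 0))).prodMap
          (Algebra.lmul ℤ (PolyModule fun a => g a.succ) (PolyModule.root fun a => g a.succ))) := by
      refine LinearMap.ext fun x => ?_
      obtain ⟨y, rfl⟩ := e.surjective x
      rw [LinearEquiv.conj_apply_apply, LinearEquiv.symm_apply_apply]
      funext a
      induction a using Fin.cases with
      | zero => rfl
      | succ a => rfl
    rw [he, LinearEquiv.charpoly_conj, LinearMap.charpoly_prodMap,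
      AdjoinRoot.charpoly_lmul_root (hg 0), ih fun a => hg a.succ, Fin.prod_univ_succ]

/-- If `N / N'` is free of finite rank, the Alexander polynomial is the characteristic polynomial
of the monodromy, up to sign. -/
theorem CPresentation.alexanderPolynomial_eq (P : CPresentation) {A : Type} [AddCommGroup A]
    [Module.Free ℤ A] [Module.Finite ℤ A] (f : Module.End ℤ A) (e : A ≃ₗ[ℤ] P.NAb)
    (he : ∀ x, e (f x) = P.monodromy (e x)) :
    P.alexanderPolynomial =
      (-1) ^ f.charpoly.natDegree * f.charpoly.map (Int.castRingHom ℂ) := by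
  have := Module.Free.of_equiv e
  have := Module.Finite.equiv e
  have hmon : P.monodromy.charpoly = f.charpoly := by
    rw [← LinearEquiv.charpoly_conj e f]
    congr 1
    refine LinearMap.ext fun x => ?_
    rw [LinearEquiv.conj_apply_apply, he, LinearEquiv.apply_symm_apply]
  have hfin : Module.Finite ℂ (ℂ ⊗[ℤ] P.NAb) := inferInstance
  rw [alexanderPolynomial, dif_pos hfin, monodromyC, LinearMap.charpoly_baseChange,
    Module.finrank_baseChange, ← LinearMap.charpoly_natDegree P.monodromy, hmon]
  rfl

/-! ### Factorization into divisors of `X ^ E - 1` with value 0 or 1 at 1. -/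

section Factorization

variable {Q : ℤ[X]} {E : ℕ}

open Classical in
/-- The product of the cyclotomic polynomials of order dividing `E` that divide `Q`. -/
noncomputable def cyclotomicRadical (Q : ℤ[X]) (E : ℕ) : ℤ[X] :=
  ∏ n ∈ E.divisors with cyclotomic n ℤ ∣ Q, cyclotomic n ℤ

theorem cyclotomicRadical_monic : (cyclotomicRadical Q E).Monic :=
  monic_prod_of_monic _ _ fun n _ => cyclotomic.monic n ℤ

theorem cyclotomicRadical_dvd_X_pow_sub_one (hE : E ≠ 0) :
    cyclotomicRadical Q E ∣ X ^ E - 1 := by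
  classical
  rw [← prod_cyclotomic_eq_X_pow_sub_one (Nat.pos_of_ne_zero hE)]
  exact Finset.prod_dvd_prod_of_subset _ _ _ (Finset.filter_subset _ _)

theorem cyclotomicRadical_dvd : cyclotomicRadical Q E ∣ Q := by
  classical
  refine Finset.prod_dvd_of_isRelPrime (fun n hn k hk hnk => ?_)
    fun n hn => (Finset.mem_filter.mp hn).2
  have hn0 := Nat.pos_of_mem_divisors (Finset.mem_filter.mp (Finset.mem_coe.mp hn)).1
  have hk0 := Nat.pos_of_mem_divisors (Finset.mem_filter.mp (Finset.mem_coe.mp hk)).1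
  refine ((cyclotomic.irreducible hn0).isRelPrime_iff_not_dvd).mpr fun h => hnk ?_
  exact cyclotomic_injective (R := ℤ) (eq_of_monic_of_associated (cyclotomic.monic n ℤ)
    (cyclotomic.monic k ℤ)
    ((cyclotomic.irreducible hn0).associated_of_dvd (cyclotomic.irreducible hk0) h))

theorem isRoot_cyclotomicRadical_iff (hE : E ≠ 0) (hQ : ∀ z : ℂ, aeval z Q = 0 → z ^ E = 1)
    (z : ℂ) : aeval z (cyclotomicRadical Q E) = 0 ↔ aeval z Q = 0 := by
  classical
  constructor
  · intro h
    obtain ⟨r, hr⟩ := cyclotomicRadical_dvd (Q := Q) (E := E)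
    rw [hr, map_mul, h, zero_mul]
  · intro h
    have hn : orderOf z ∣ E := orderOf_dvd_of_pow_eq_one (hQ z h)
    have hpos : 0 < orderOf z := Nat.pos_of_dvd_of_pos hn (Nat.pos_of_ne_zero hE)
    have hmin := cyclotomic_eq_minpoly (IsPrimitiveRoot.orderOf z) hpos
    have hdvd : cyclotomic (orderOf z) ℤ ∣ cyclotomicRadical Q E := by
      refine Finset.dvd_prod_of_mem _ (Finset.mem_filter.mpr ⟨Nat.mem_divisors.mpr ⟨hn, hE⟩, ?_⟩)
      rw [hmin]
      exact minpoly.isIntegrallyClosed_dvd ((IsPrimitiveRoot.orderOf z).isIntegral hpos) h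
    obtain ⟨r, hr⟩ := hdvd
    rw [hr, map_mul, hmin, minpoly.aeval, zero_mul]

theorem rootMultiplicity_map_eq_zero_iff (hQ0 : Q ≠ 0) (z : ℂ) :
    (Q.map (Int.castRingHom ℂ)).rootMultiplicity z = 0 ↔ aeval z Q ≠ 0 := by
  have h0 : Q.map (Int.castRingHom ℂ) ≠ 0 :=
    (Polynomial.map_ne_zero_iff (RingHom.injective_int _)).mpr hQ0
  rw [rootMultiplicity_eq_zero_iff, IsRoot.def, eval_map, aeval_def]
  simp only [h0, imp_false]
  rfl

/-- The radical divides the separable polynomial `X ^ E - 1`, so its roots, which are those of `Q`,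
are simple. -/
theorem rootMultiplicity_cyclotomicRadical (hE : E ≠ 0)
    (hQ : ∀ z : ℂ, aeval z Q = 0 → z ^ E = 1) {z : ℂ} (hz : aeval z Q = 0) :
    ((cyclotomicRadical Q E).map (Int.castRingHom ℂ)).rootMultiplicity z = 1 := by
  refine le_antisymm ?_ (Nat.one_le_iff_ne_zero.mpr fun h => ?_)
  · have hsep : (X ^ E - 1 : ℂ[X]).Separable :=
      (X_pow_sub_one_separable_iff).mpr (Nat.cast_ne_zero.mpr hE)
    have hdvd := Polynomial.map_dvd (Int.castRingHom ℂ)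
      (cyclotomicRadical_dvd_X_pow_sub_one (Q := Q) hE)
    rw [Polynomial.map_sub, Polynomial.map_pow, map_X, Polynomial.map_one] at hdvd
    exact rootMultiplicity_le_one_of_separable (hsep.of_dvd hdvd) z
  · rw [rootMultiplicity_map_eq_zero_iff cyclotomicRadical_monic.ne_zero] at h
    exact h ((isRoot_cyclotomicRadical_iff hE hQ z).mpr hz)

theorem eval_one_cyclotomicRadical (hE : E ≠ 0) (hQ0 : Q ≠ 0)
    (hQ : ∀ z : ℂ, aeval z Q = 0 → z ^ E = 1)
    (hmult : ∀ (p k : ℕ) (ζ : ℂ), p.Prime → IsPrimitiveRoot ζ (p ^ k) →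
      (Q.map (Int.castRingHom ℂ)).rootMultiplicity ζ ≤
        (Q.map (Int.castRingHom ℂ)).rootMultiplicity 1) :
    (cyclotomicRadical Q E).eval 1 = 0 ∨ (cyclotomicRadical Q E).eval 1 = 1 := by
  classical
  by_cases h1 : aeval (1 : ℂ) Q = 0
  · left
    have h := (isRoot_cyclotomicRadical_iff hE hQ 1).mpr h1
    rw [← map_one (algebraMap ℤ ℂ), aeval_algebraMap_apply, coe_aeval_eq_eval] at h
    exact (FaithfulSMul.algebraMap_eq_zero_iff ℤ ℂ).mp h
  · right
    rw [cyclotomicRadical, eval_prod]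
    refine Finset.prod_eq_one fun n hn => ?_
    obtain ⟨hnE, hnQ⟩ := Finset.mem_filter.mp hn
    -- If `n` were a prime power (`n = p ^ 0 = 1` included), a primitive `n`-th root of unity would
    -- be a root of `Q`, and by `hmult` so would 1.
    refine eval_one_cyclotomic_not_prime_pow fun {p} hp k hk => ?_
    have hn0 : n ≠ 0 := (Nat.pos_of_mem_divisors hnE).ne'
    have hζ := Complex.isPrimitiveRoot_exp n hn0
    set ζ := Complex.exp (2 * Real.pi * Complex.I / n)
    have hζQ : aeval ζ Q = 0 := by
      obtain ⟨r, hr⟩ := hnQ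
      rw [hr, map_mul, cyclotomic_eq_minpoly hζ (Nat.pos_of_ne_zero hn0), minpoly.aeval, zero_mul]
    have hle := hmult p k ζ hp (hk ▸ hζ)
    rw [(rootMultiplicity_map_eq_zero_iff hQ0 1).mpr h1, Nat.le_zero,
      rootMultiplicity_map_eq_zero_iff hQ0] at hle
    exact hle hζQ

/-- A monic integral polynomial whose roots are `E`-th roots of unity, with multiplicities at
roots of prime power order bounded by that at `1`, is a product of divisors of `X ^ E - 1` whose
values at `1` are `0` or `1`. -/
theorem exists_list_prod_eq (hE : E ≠ 0) (hmonic : Q.Monic)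
    (hQ : ∀ z : ℂ, aeval z Q = 0 → z ^ E = 1)
    (hmult : ∀ (p k : ℕ) (ζ : ℂ), p.Prime → IsPrimitiveRoot ζ (p ^ k) →
      (Q.map (Int.castRingHom ℂ)).rootMultiplicity ζ ≤
        (Q.map (Int.castRingHom ℂ)).rootMultiplicity 1) :
    ∃ L : List ℤ[X], L.prod = Q ∧
      ∀ g ∈ L, g.Monic ∧ g ∣ X ^ E - 1 ∧ (g.eval 1 = 0 ∨ g.eval 1 = 1) := by
  induction hn : Q.natDegree using Nat.strong_induction_on generalizing Q with
  | _ n ih =>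
    by_cases hdeg : Q.natDegree = 0
    · exact ⟨[], (hmonic.natDegree_eq_zero.mp hdeg).symm, by simp⟩
    have hg := cyclotomicRadical_monic (Q := Q) (E := E)
    obtain ⟨Q', hQ'⟩ := cyclotomicRadical_dvd (Q := Q) (E := E)
    have hmonic' : Q'.Monic := by
      rw [hQ'] at hmonic
      exact hg.of_mul_monic_left hmonic
    have hinj := RingHom.injective_int (Int.castRingHom ℂ)
    have hmul : ∀ z : ℂ, (Q.map (Int.castRingHom ℂ)).rootMultiplicity z =
        ((cyclotomicRadical Q E).map (Int.castRingHom ℂ)).rootMultiplicity z +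
          (Q'.map (Int.castRingHom ℂ)).rootMultiplicity z := by
      intro z
      conv_lhs => rw [hQ']
      rw [Polynomial.map_mul, rootMultiplicity_mul]
      exact mul_ne_zero ((Polynomial.map_ne_zero_iff hinj).mpr hg.ne_zero)
        ((Polynomial.map_ne_zero_iff hinj).mpr hmonic'.ne_zero)
    have hlt : Q'.natDegree < n := by
      have hdegQ : (Q.map (Int.castRingHom ℂ)).degree ≠ 0 := by
        rw [hmonic.degree_map, degree_eq_natDegree hmonic.ne_zero]
        exact_mod_cast hdeg
      obtain ⟨z, hz⟩ := IsAlgClosed.exists_root _ hdegQ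
      have hz' : aeval z Q = 0 := by rwa [IsRoot.def, eval_map] at hz
      -- A nonconstant `Q` has a complex root, which the radical shares; hence the degree drops and
      -- the induction proceeds.
      have hpos : (cyclotomicRadical Q E).natDegree ≠ 0 := by
        intro h
        have h1 := (isRoot_cyclotomicRadical_iff hE hQ z).mpr hz'
        rw [hg.natDegree_eq_zero.mp h] at h1
        simp at h1
      have := hg.natDegree_mul hmonic'
      rw [← hQ'] at this
      omega
    obtain ⟨L, hL, hL'⟩ := ih _ hlt hmonic'
      (fun z hz => hQ z (by rw [hQ', map_mul, hz, mul_zero]))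
      (fun p k ζ hp hζ => by
        have hle := hmult p k ζ hp hζ
        have h0 := hmul ζ
        have h1 := hmul 1
        -- The multiplicity bound passes to the cofactor: if `ζ` is a root of `Q`, so is 1, and both
        -- multiplicities drop by exactly one. If not, the multiplicity at `ζ` is already zero.
        by_cases hζQ : aeval ζ Q = 0
        · have hζ0 := rootMultiplicity_cyclotomicRadical hE hQ hζQ
          have h1Q : aeval (1 : ℂ) Q = 0 := by
            by_contra h
            rw [← ne_eq, ← rootMultiplicity_map_eq_zero_iff hmonic.ne_zero] at h
            omega
          have := rootMultiplicity_cyclotomicRadical hE hQ h1Q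
          omega
        · rw [← ne_eq, ← rootMultiplicity_map_eq_zero_iff hmonic.ne_zero] at hζQ
          omega) rfl
    refine ⟨cyclotomicRadical Q E :: L, by rw [List.prod_cons, hL, ← hQ'], ?_⟩
    intro g hgL
    rcases List.mem_cons.mp hgL with rfl | hgL
    · exact ⟨hg, cyclotomicRadical_dvd_X_pow_sub_one hE,
        eval_one_cyclotomicRadical hE hmonic.ne_zero hQ hmult⟩
    · exact hL' g hgL

theorem exists_common_exponent (hQ0 : Q ≠ 0)
    (hroots : ∀ z : ℂ, aeval z Q = 0 → ∃ n : ℕ, 0 < n ∧ z ^ n = 1) :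
    ∃ E : ℕ, E ≠ 0 ∧ ∀ z : ℂ, aeval z Q = 0 → z ^ E = 1 := by
  have hmem : ∀ z : ℂ, z ∈ (Q.aroots ℂ).toFinset ↔ aeval z Q = 0 := by
    intro z
    rw [Multiset.mem_toFinset, mem_aroots]
    exact and_iff_right hQ0
  refine ⟨∏ z ∈ (Q.aroots ℂ).toFinset, orderOf z, ?_, fun z hz => ?_⟩
  · refine Finset.prod_ne_zero_iff.mpr fun z hz => ?_
    obtain ⟨n, hn, hzn⟩ := hroots z ((hmem z).mp hz)
    exact (orderOf_pos_iff.mpr (isOfFinOrder_iff_pow_eq_one.mpr ⟨n, hn, hzn⟩)).ne'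
  · exact orderOf_dvd_iff_pow_eq_one.mp (Finset.dvd_prod_of_mem _ ((hmem z).mpr hz))

end Factorization

/-! ### Assembly of the main theorem. -/

theorem theorem0p2 (m : ℕ) (P : Polynomial ℤ)
    (hdeg : P.natDegree = m) (hlead : P.coeff m = (-1) ^ m)
    (hroots : ∀ z : ℂ, Polynomial.aeval z P = 0 → ∃ n : ℕ, 0 < n ∧ z ^ n = 1)
    (hmult : ∀ (p k : ℕ) (ζ : ℂ), p.Prime → IsPrimitiveRoot ζ (p ^ k) →
      (P.map (Int.castRingHom ℂ)).rootMultiplicity ζ ≤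
        (P.map (Int.castRingHom ℂ)).rootMultiplicity 1) :
    ∃ G : CPresentation, G.IsHurwitzCGroup ∧
      G.alexanderPolynomial = P.map (Int.castRingHom ℂ) := by
  have hP0 : P ≠ 0 := by
    rintro rfl
    rw [Polynomial.coeff_zero] at hlead
    exact pow_ne_zero m (by norm_num) hlead.symm
  -- The sign in `det (h - t Id)` is removed to get a monic polynomial; roots and multiplicities are
  -- those of `P`.
  obtain ⟨Q, hQ, hPQ, hQP⟩ : ∃ Q : ℤ[X], Q.Monic ∧ P = (-1) ^ m * Q ∧ (Q = P ∨ Q = -P) := by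
    have hsq : ((-1) ^ m * (-1) ^ m : ℤ) = 1 := by rw [← mul_pow]; simp
    refine ⟨C ((-1) ^ m) * P, ?_, ?_, ?_⟩
    · rw [Monic, leadingCoeff_mul, leadingCoeff_C, leadingCoeff, hdeg, hlead, hsq]
    · rw [← mul_assoc, ← C_1, ← C_neg, ← C_pow, ← C_mul, hsq, C_1, one_mul]
    · rcases neg_one_pow_eq_or ℤ m with h | h <;> rw [h] <;> simp
  have hroot : ∀ z : ℂ, aeval z Q = 0 ↔ aeval z P = 0 := by
    intro z
    rcases hQP with rfl | rfl <;> simp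
  have hmul : ∀ z : ℂ, (Q.map (Int.castRingHom ℂ)).rootMultiplicity z =
      (P.map (Int.castRingHom ℂ)).rootMultiplicity z := by
    intro z
    rcases hQP with rfl | rfl
    · rfl
    · rw [Polynomial.map_neg, ← count_roots, ← count_roots, roots_neg]
  obtain ⟨E, hE0, hE⟩ := exists_common_exponent hP0 hroots
  obtain ⟨L, hL, hL'⟩ := exists_list_prod_eq hE0 hQ (fun z hz => hE z ((hroot z).mp hz))
    (fun p k ζ hp hζ => by rw [hmul, hmul]; exact hmult p k ζ hp hζ)
  let g : Fin L.length → ℤ[X] := L.get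
  have hg : ∀ a, (g a).Monic ∧ g a ∣ X ^ E - 1 ∧ ((g a).eval 1 = 0 ∨ (g a).eval 1 = 1) :=
    fun a => hL' _ (List.get_mem L a)
  have hfree : ∀ a, Module.Free ℤ (AdjoinRoot (g a)) := fun a => (hg a).1.free_adjoinRoot
  have hfin : ∀ a, Module.Finite ℤ (AdjoinRoot (g a)) := fun a => (hg a).1.finite_adjoinRoot
  refine ⟨CPresentation.ofPolys E hE0 g,
    (CPresentation.isHurwitz_ofPolys E hE0 g).isHurwitzCGroup, ?_⟩
  obtain ⟨e, he⟩ := CPresentation.exists_equiv_NAb_ofPolys E hE0 g (fun a => (hg a).2.1)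
    (fun a => (hg a).2.2)
  have hprod : ∏ a, g a = Q := by
    rw [← hL, ← List.prod_ofFn, List.ofFn_get]
  have hdegQ : Q.natDegree = m := by
    rcases hQP with rfl | rfl
    · exact hdeg
    · rw [natDegree_neg, hdeg]
  rw [CPresentation.alexanderPolynomial_eq _
    (Algebra.lmul ℤ (PolyModule g) (PolyModule.root g)) e he,
    PolyModule.charpoly_lmul_root (fun a => (hg a).1), hprod, hdegQ, hPQ]
  simp
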